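/- Let $\lambda$ be Lebesgue measure on $[0,1]$, let $L^1=L^1([0,1])$ and $L^\infty=L^\infty([0,1])$ (functions modulo a.e. equality), and let $\mathbf 1$ be the constant function $1$ on $[0,1]$. Let $\hat{\mathcal C}\subseteq L^1$ be the set of (classes of) non-decreasing left-continuous functions $[0,1]\to\mathbb R$, and let $\mathcal W=\{\nu\in L^\infty:\ \nu\ge 0\text{ a.e.},\ \int_0^1\nu(t)\,dt=1\}$. For $\varphi\in L^1$ let $\varphi^q(t)=\inf\{s\in\mathbb R:\ \lambda(\{u\in[0,1]:\varphi(u)\le s\})\ge t\}$, which is finite for $0<t<1$. Call $\varphi,\psi\in L^1$ comonotonic if $(\varphi(s)-\varphi(t))(\psi(s)-\psi(t))\ge 0$ for almost every $(s,t)\in[0,1]^2$. For $\mathcal D\in\{\hat{\mathcal C},L^1\}$ (both are closed under sums, multiplication by nonnegative scalars and addition of constants) and $f:\mathcal D\to\mathbb R$ consider the properties: * (D1) $f(a\varphi+b\mathbf 1)=af(\varphi)+b$ for all $\varphi\in\mathcal D$, $a\ge 0$, $b\in\mathbb R$; * (D2) $f(\varphi)\le f(\psi)$ whenever $\varphi,\psi\in\mathcal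 D$ and $\varphi\le\psi$ a.e.; * (D3) $f(\varphi+\psi)=f(\varphi)+f(\psi)$ for all comonotonic $\varphi,\psi\in\mathcal D$; * (D3') $f(\varphi+\psi)=f(\varphi)+f(\psi)$ for all $\varphi,\psi\in\mathcal D$; * (D4) (for $\mathcal D=L^1$) $f(\varphi\circ T)=f(\varphi)$ for all $\varphi\in L^1$ and all $\lambda$-preserving maps $T:[0,1]\to[0,1]$; * (D5) there is $M>0$ with $|f(\varphi)-f(\psi)|\le M\|\varphi-\psi\|_{L^1}$ for all $\varphi,\psi\in\mathcal D$. Then: 1. A function $f:\hat{\mathcal C}\to\mathbb R$ satisfies (D1), (D2), (D3) and (D5) if and only if there is a unique $\nu^*\in\mathcal W$ with $f(\varphi)=\int_0^1\varphi(t)\nu^*(t)\,dt$ for all $\varphi\in\hat{\mathcal C}$. In particular, for every $f:L^1\to\mathbb R$ satisfying (D1), (D2), (D3) and (D5) on $L^1$ there is a unique $\nu^*\in\mathcal W$ with $f(\varphi)=\int_0^1\varphi(t)\nu^*(t)\,dt$ for all $\varphi\in\hat{\mathcal C}$. 2. A function $f:L^1\to\mathbb R$ satisfies (D1), (D2), (D3),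 (D4) and (D5) if and only if there is a unique $\nu^*\in\mathcal W$ such that, for all $\varphi\in L^1$, $\varphi^q\nu^*$ is integrable and $f(\varphi)=\int_0^1\varphi^q(t)\nu^*(t)\,dt$. 3. A function $f:L^1\to\mathbb R$ satisfies (D1), (D2), (D3') and (D5) if and only if there is a unique $\nu^*\in\mathcal W$ with $f(\varphi)=\int_0^1\varphi(t)\nu^*(t)\,dt$ for all $\varphi\in L^1$. 4. A function $f:L^1\to\mathbb R$ satisfies (D1), (D2), (D3'), (D4) and (D5) if and only if $f(\varphi)=\int_0^1\varphi(t)\,dt$ for all $\varphi\in L^1$. In that case every $\nu^*\in\mathcal W$ with $f(\varphi)=\int_0^1\varphi(t)\nu^*(t)\,dt$ for all $\varphi\in L^1$ equals $1$ a.e. -/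

import Mathlib

open MeasureTheory
open scoped ENNReal

namespace WGRM

/-- The space `L¹([0,1])` of classes of integrable real functions for Lebesgue measure. -/
abbrev L1 : Type := Lp ℝ 1 (volume : Measure unitInterval)

/-- The space `L^∞([0,1])` of classes of essentially bounded real functions. -/
abbrev Linfty : Type := Lp ℝ ∞ (volume : Measure unitInterval)

/-- The constant function `1_{[0,1]}`, as an element of `L¹([0,1])`. -/
noncomputable def one : L1 := Lp.const 1 (volume : Measure unitInterval) (1 : ℝ)

/-- The non-decreasing left-continuous functions `[0,1] → ℝ`, as a subset of `L¹([0,1])`. -/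
def monoCone : Set L1 :=
  {φ | ∃ g : unitInterval → ℝ, Monotone g ∧ (∀ t, ContinuousWithinAt g (Set.Iic t) t) ∧
    φ =ᵐ[volume] g}

/-- Bounded probability densities on `[0,1]`. -/
def densities : Set Linfty :=
  {ν | 0 ≤ᵐ[volume] ν ∧ ∫ t, ν t = 1}

/-- The quantile function `φ^q(t) = inf {s | λ{u | φ(u) ≤ s} ≥ t}`. It depends on `φ` only up to
null sets. For `0 < t < 1` the set is non-empty and bounded below; at the endpoints, where the
infimum can be infinite, the value is irrelevant for integrals. -/
noncomputable def quantile (φ : unitInterval → ℝ) (t : unitInterval) : ℝ :=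
  sInf {s : ℝ | ENNReal.ofReal (t : ℝ) ≤ volume {u : unitInterval | φ u ≤ s}}

/-- `(φ(s) - φ(t)) (ψ(s) - ψ(t)) ≥ 0` for almost all `(s, t)`. -/
def Comonotonic (φ ψ : L1) : Prop :=
  ∀ᵐ p : unitInterval × unitInterval ∂((volume : Measure unitInterval).prod volume),
    0 ≤ (φ p.1 - φ p.2) * (ψ p.1 - ψ p.2)

/-! Properties of an aggregation function with domain `D ⊆ L¹([0,1])`; below, `D` is either the
cone `monoCone` or the whole space. Values of `f` outside `D` play no role, since both choices of
`D` are closed under addition, multiplication by `a ≥ 0` and addition of constants. -/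

def AffineInvariantOn (D : Set L1) (f : L1 → ℝ) : Prop :=
  ∀ φ ∈ D, ∀ a b : ℝ, 0 ≤ a → f (a • φ + b • one) = a * f φ + b

def PointwiseMonotoneOn (D : Set L1) (f : L1 → ℝ) : Prop :=
  ∀ φ ∈ D, ∀ ψ ∈ D, φ ≤ᵐ[volume] ψ → f φ ≤ f ψ

def ComonotonicAdditiveOn (D : Set L1) (f : L1 → ℝ) : Prop :=
  ∀ φ ∈ D, ∀ ψ ∈ D, Comonotonic φ ψ → f (φ + ψ) = f φ + f ψ

def L1LipschitzOn (D : Set L1) (f : L1 → ℝ) : Prop :=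
  ∃ M : ℝ, 0 < M ∧ ∀ φ ∈ D, ∀ ψ ∈ D, |f φ - f ψ| ≤ M * ‖φ - ψ‖

/-- Full additivity on `L¹([0,1])`. -/
def FullyAdditive (f : L1 → ℝ) : Prop :=
  ∀ φ ψ : L1, f (φ + ψ) = f φ + f ψ

/-- `f(φ ∘ T) = f(φ)` for every measure-preserving, not necessarily invertible, `T`. -/
def StronglyPermutationInvariant (f : L1 → ℝ) : Prop :=
  ∀ (T : unitInterval → unitInterval) (hT : MeasurePreserving T volume volume) (φ : L1),
    f φ = f (Lp.compMeasurePreserving T hT φ)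

end WGRM

/-! Any two elements of the cone are comonotonic, so comonotonic additivity is plain additivity
there. With homogeneity and the Lipschitz bound, `f` extends linearly to differences of cone
elements, and then by Hahn–Banach to all of `L¹` (`exists_extension_of_cone`); the extension is
integration against a bounded `ν` (`exists_Linfty_repr`). Testing on indicators of `(s,1]`, which
lie in the cone, makes `ν` unique and nonnegative (`Linfty_le_of_step`). The fully additive case is
the same argument with the cone replaced by `L¹`.

For permutation-invariant `f`, every `φ` equals its quantile function composed with a
measure-preserving rank map (`measurePreserving_rank`, `quantile_comp_rank`), so `f φ` is `f` at the
quantile function, where the cone representation applies after truncation. Conversely, comonotonic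
functions factor through one rank map, that of their sum, so quantiles add
(`quantile_add_of_comonotonic`); quantiles also contract `L¹` distances.

If `f` is moreover fully additive, invariance forces `ν` to agree with its quantile function and
with the reflection of that function. Being monotone and symmetric, it is constant. -/

namespace WGRM

open Set Filter Topology

/-! ### Bounded functionals on `L¹` -/

/-- Integration against a bounded function, as a continuous linear functional on `L¹`. -/
noncomputable def pairing (ν : Linfty) : L1 →L[ℝ] ℝ :=
  (ContinuousLinearMap.mul ℝ ℝ).lpPairing volume ∞ 1 ν

theorem pairing_apply (ν : Linfty) (φ : L1) : pairing ν φ = ∫ t, φ t * ν t := by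
  simp only [pairing, ContinuousLinearMap.lpPairing_eq_integral, ContinuousLinearMap.mul_apply']
  exact integral_congr_ae (.of_forall fun t => mul_comm _ _)

theorem integrable_Linfty (ν : Linfty) : Integrable ν :=
  (Lp.memLp ν).integrable (by simp)

theorem integrable_L1 (φ : L1) : Integrable φ :=
  memLp_one_iff_integrable.1 (Lp.memLp φ)

theorem integrable_mul_Linfty {g : unitInterval → ℝ} (hg : Integrable g) (ν : Linfty) :
    Integrable fun t => g t * ν t :=
  memLp_one_iff_integrable.1
    ((Lp.memLp ν).mul (p := 1) (q := ∞) (r := 1) (memLp_one_iff_integrable.2 hg))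

/-- Every continuous linear functional on `L¹([0,1])` is integration against a bounded function. -/
theorem exists_Linfty_repr (F : L1 →L[ℝ] ℝ) : ∃ ν : Linfty, ∀ φ, F φ = ∫ t, φ t * ν t := by
  -- Hölder against the constant `1` embeds `L²` continuously in `L¹`, so Riesz representation on
  -- the Hilbert space `L²` supplies a candidate density `g`.
  let o : Lp ℝ 2 (volume : Measure unitInterval) := Lp.const 2 volume 1
  let ι : Lp ℝ 2 (volume : Measure unitInterval) →L[ℝ] L1 :=
    (ContinuousLinearMap.mul ℝ ℝ).holderL volume 2 2 1 o
  have hι : ∀ φ, ι φ =ᵐ[volume] φ := fun φ => by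
    have h1 := (ContinuousLinearMap.mul ℝ ℝ).coeFn_holder (r := 1) o φ
    filter_upwards [h1] with t h1
    change ((ContinuousLinearMap.mul ℝ ℝ).holder 1 o φ) t = _
    rw [h1]
    simp [o]
  let g := (InnerProductSpace.toDual ℝ _).symm (F.comp ι)
  have hgI : Integrable g := (Lp.memLp g).integrable (by norm_num)
  have hind : ∀ (A : Set unitInterval) (hA : MeasurableSet A),
      F (indicatorConstLp 1 hA (measure_ne_top _ _) 1) = ∫ t in A, g t := by
    intro A hA
    have h1 : inner ℝ g (indicatorConstLp 2 hA (measure_ne_top _ _) (1 : ℝ)) =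
        (F.comp ι) (indicatorConstLp 2 hA (measure_ne_top _ _) (1 : ℝ)) :=
      InnerProductSpace.toDual_symm_apply
    rw [real_inner_comm, L2.inner_indicatorConstLp_one] at h1
    rw [h1, ContinuousLinearMap.comp_apply]
    congr 1
    apply Lp.ext
    exact indicatorConstLp_coeFn.trans (indicatorConstLp_coeFn.symm.trans (hι _).symm)
  -- Indicators have `L¹` norm equal to the measure of the set, so averages of `g` are bounded by
  -- `‖F‖`; hence so is `g`.
  have hbd : ∀ (A : Set unitInterval), MeasurableSet A →
      |∫ t in A, g t| ≤ ‖F‖ * volume.real A := by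
    intro A hA
    rw [← hind A hA, ← Real.norm_eq_abs]
    refine (F.le_opNorm _).trans ?_
    gcongr
    simpa using norm_indicatorConstLp_le (p := 1) (hs := hA)
      (hμs := measure_ne_top (volume : Measure unitInterval) A) (c := (1 : ℝ))
  have hup : g ≤ᵐ[volume] fun _ => ‖F‖ := by
    refine ae_le_of_forall_setIntegral_le hgI (integrable_const _) fun A hA _ => ?_
    have := (abs_le.1 (hbd A hA)).2
    simpa [mul_comm] using this
  have hlo : (fun _ => -‖F‖) ≤ᵐ[volume] g := by
    refine ae_le_of_forall_setIntegral_le (integrable_const _) hgI fun A hA _ => ?_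
    have := (abs_le.1 (hbd A hA)).1
    simpa [mul_comm] using this
  have hg : MemLp g ∞ volume := by
    refine memLp_top_of_bound hgI.aestronglyMeasurable ‖F‖ ?_
    filter_upwards [hup, hlo] with t h1 h2
    exact abs_le.2 ⟨h2, h1⟩
  refine ⟨hg.toLp, fun φ => ?_⟩
  rw [← pairing_apply]
  induction φ using Lp.induction ENNReal.one_ne_top with
  | @indicatorConst c s hs hμs =>
    have h : ((Lp.simpleFunc.indicatorConst 1 hs hμs.ne c : Lp.simpleFunc ℝ 1 volume) : L1) =
        c • indicatorConstLp 1 hs (measure_ne_top _ _) (1 : ℝ) := by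
      rw [Lp.simpleFunc.coe_indicatorConst]
      apply Lp.ext
      filter_upwards [indicatorConstLp_coeFn (p := 1) (hs := hs) (hμs := hμs.ne) (c := c),
        indicatorConstLp_coeFn (p := 1) (hs := hs) (hμs := hμs.ne) (c := (1 : ℝ)),
        Lp.coeFn_smul c (indicatorConstLp 1 hs hμs.ne (1 : ℝ))] with t h1 h2 h3
      rw [h1, h3, Pi.smul_apply, h2]
      by_cases ht : t ∈ s <;> simp [ht]
    rw [h, map_smul, map_smul, hind s hs, pairing_apply]
    congr 1
    rw [← integral_indicator hs]
    apply integral_congr_ae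
    filter_upwards [hg.coeFn_toLp,
      indicatorConstLp_coeFn (p := 1) (hs := hs) (hμs := hμs.ne) (c := (1 : ℝ))] with t h1 h2
    rw [h1, h2]
    by_cases ht : t ∈ s <;> simp [ht]
  | add hf hg _ h1 h2 => rw [map_add, map_add, h1, h2]
  | isClosed => exact isClosed_eq F.continuous (pairing _).continuous

/-! ### Testing densities on intervals -/

/-- A function whose integrals over all intervals are nonnegative is nonnegative. -/
theorem ae_nonneg_of_setIntegral_Ioc_nonneg {h : unitInterval → ℝ} (hh : Integrable h)
    (hpos : ∀ a b : unitInterval, a ≤ b → 0 ≤ ∫ t in Ioc a b, h t) : 0 ≤ᵐ[volume] h := by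
  let p := projIcc (0 : ℝ) 1 zero_le_one
  let H : ℝ → ℝ := (Icc (0 : ℝ) 1).indicator (fun x => h (p x))
  have hpc : ∀ t : unitInterval, p t = t := fun t => projIcc_val _ t
  have hemb := unitInterval.measurableEmbedding_coe
  have hmp := unitInterval.measurePreserving_coe
  have hH : Integrable H := by
    rw [integrable_indicator_iff measurableSet_Icc]
    change Integrable _ (volume.restrict unitInterval)
    rw [← hmp.integrable_comp_emb hemb]
    exact hh.congr (.of_forall fun t => by simp [hpc])
  have hint : ∀ x : ℝ, 0 ≤ x → ∫ t in (0 : ℝ)..x, H t = ∫ t in Ioc 0 (p x), h t := by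
    intro x hx
    rw [intervalIntegral.integral_of_le hx, integral_indicator measurableSet_Icc,
      Measure.restrict_restrict measurableSet_Icc, inter_comm,
      ← Measure.restrict_restrict measurableSet_Ioc]
    have h1 := hmp.setIntegral_preimage_emb hemb (fun y => h (p y)) (Ioc 0 x)
    simp only [hpc] at h1
    refine h1.symm.trans ?_
    congr 2
    ext t
    simp only [mem_preimage, mem_Ioc]
    refine and_congr Iff.rfl ?_
    rw [← Subtype.coe_le_coe, coe_projIcc]
    simp [t.2.2, hx]
  -- Clamping by `p` makes the primitive monotone on all of `ℝ`, so its derivative, which is `H`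
  -- almost everywhere on `(0,1]`, is nonnegative.
  have hmono : Monotone fun x => ∫ t in Ioc 0 (p x), h t := by
    intro x y hxy
    have hp : p x ≤ p y := monotone_projIcc _ hxy
    have h0 : (0 : unitInterval) ≤ p x := unitInterval.nonneg'
    change (∫ t in Ioc 0 (p x), h t) ≤ ∫ t in Ioc 0 (p y), h t
    rw [← Ioc_union_Ioc_eq_Ioc h0 hp, setIntegral_union (Ioc_disjoint_Ioc_of_le le_rfl)
      measurableSet_Ioc hh.integrableOn hh.integrableOn]
    linarith [hpos _ _ hp]
  have hHpos : ∀ᵐ x : ℝ, x ∈ Ioc (0 : ℝ) 1 → 0 ≤ H x := by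
    filter_upwards [LocallyIntegrable.ae_hasDerivAt_integral hH.locallyIntegrable] with x hx hx0
    have := (hx 0).congr_of_eventuallyEq (f₁ := fun x => ∫ t in Ioc 0 (p x), h t) <| by
      filter_upwards [lt_mem_nhds hx0.1] with y hy
      exact (hint y hy.le).symm
    rw [← this.deriv]
    exact hmono.deriv_nonneg
  have h2 := hmp.quasiMeasurePreserving.ae (ae_restrict_of_ae hHpos)
  have h3 : ∀ᵐ t : unitInterval, t ≠ 0 := by simp [ae_iff]
  filter_upwards [h2, h3] with t ht h0
  have := ht ⟨unitInterval.pos_iff_ne_zero.2 h0, t.2.2⟩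
  have hH' : H t = h t := by
    simp only [H, indicator_of_mem (show (t : ℝ) ∈ Icc (0 : ℝ) 1 from t.2), hpc]
  rwa [hH'] at this

/-- Step functions `1_{(s,1]}` as elements of `L¹`. -/
noncomputable def step (s : unitInterval) : L1 :=
  indicatorConstLp 1 (measurableSet_Ioi (a := s)) (measure_ne_top _ _) (1 : ℝ)

theorem step_mem (s : unitInterval) : step s ∈ monoCone := by
  refine ⟨(Ioi s).indicator fun _ => 1, ?_, fun t => ?_, indicatorConstLp_coeFn⟩
  · intro a b hab
    by_cases ha : s < a
    · simp [ha, ha.trans_le hab]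
    · simp only [mem_Ioi, ha, not_false_eq_true, indicator_of_notMem]
      exact indicator_nonneg (fun _ _ => zero_le_one) b
  · by_cases ht : s < t
    · refine ContinuousAt.continuousWithinAt ?_
      refine (continuousAt_const (y := (1 : ℝ))).congr ?_
      filter_upwards [lt_mem_nhds ht] with u (hu : s < u)
      simp [hu]
    · refine (continuousWithinAt_const (b := (0 : ℝ))).congr (fun u hu => ?_) ?_
      · simp [(not_lt.1 ht).trans' hu]
      · simpa using ht

theorem pairing_step (ν : Linfty) (s : unitInterval) : pairing ν (step s) = ∫ t in Ioi s, ν t := by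
  rw [pairing_apply, ← integral_indicator measurableSet_Ioi]
  apply integral_congr_ae
  filter_upwards [indicatorConstLp_coeFn (p := 1) (hs := measurableSet_Ioi (a := s))
    (hμs := measure_ne_top volume _) (c := (1 : ℝ))] with t h1
  rw [step, h1]
  by_cases ht : t ∈ Ioi s <;> simp [ht]

theorem setIntegral_Ioc_eq_pairing (ν : Linfty) {a b : unitInterval} (hab : a ≤ b) :
    ∫ t in Ioc a b, ν t = pairing ν (step a) - pairing ν (step b) := by
  rw [pairing_step, pairing_step, eq_sub_iff_add_eq, ← setIntegral_union _ measurableSet_Ioi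
    (integrable_Linfty ν).integrableOn (integrable_Linfty ν).integrableOn, Ioc_union_Ioi_eq_Ioi hab]
  exact Set.disjoint_left.2 fun t h1 h2 => not_lt.2 h1.2 h2

/-- `step a - step b` is the indicator of `(a,b]`, so this compares integrals over intervals. It
serves both uniqueness and, with `ν = 0`, positivity. -/
theorem Linfty_le_of_step {ν ν' : Linfty}
    (h : ∀ a b : unitInterval, a ≤ b →
      pairing ν (step a) - pairing ν (step b) ≤ pairing ν' (step a) - pairing ν' (step b)) :
    ν ≤ᵐ[volume] ν' := by
  have := ae_nonneg_of_setIntegral_Ioc_nonneg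
    ((integrable_Linfty ν').sub (integrable_Linfty ν)) fun a b hab => by
      simp only [Pi.sub_apply]
      rw [integral_sub (integrable_Linfty ν').integrableOn (integrable_Linfty ν).integrableOn,
        setIntegral_Ioc_eq_pairing _ hab, setIntegral_Ioc_eq_pairing _ hab]
      linarith [h a b hab]
  filter_upwards [this] with t ht
  simpa using ht

theorem Linfty_ext_of_step {ν ν' : Linfty} (h : ∀ s, pairing ν (step s) = pairing ν' (step s)) :
    ν = ν' :=
  Lp.ext ((Linfty_le_of_step fun a b _ => by rw [h, h]).antisymm
    (Linfty_le_of_step fun a b _ => by rw [h, h]))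

/-! ### The monotone cone -/

theorem one_coeFn : one =ᵐ[volume] fun _ => (1 : ℝ) := Lp.coeFn_const 1 volume 1

theorem coeFn_affine (φ : L1) (a b : ℝ) :
    (a • φ + b • one : L1) =ᵐ[volume] fun t => a * φ t + b := by
  filter_upwards [Lp.coeFn_add (a • φ) (b • one), Lp.coeFn_smul a φ, Lp.coeFn_smul b one,
    one_coeFn] with t h1 h2 h3 h4
  rw [h1, Pi.add_apply, h2, Pi.smul_apply, h3, Pi.smul_apply, h4, smul_eq_mul, smul_eq_mul, mul_one]

theorem pairing_one (ν : Linfty) : pairing ν one = ∫ t, ν t := by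
  rw [pairing_apply]
  apply integral_congr_ae
  filter_upwards [one_coeFn] with t h
  rw [h, one_mul]

theorem monoCone_add {φ ψ : L1} (hφ : φ ∈ monoCone) (hψ : ψ ∈ monoCone) : φ + ψ ∈ monoCone := by
  obtain ⟨g, hg, hgc, hgφ⟩ := hφ
  obtain ⟨k, hk, hkc, hkψ⟩ := hψ
  exact ⟨g + k, hg.add hk, fun t => (hgc t).add (hkc t), (Lp.coeFn_add φ ψ).trans (hgφ.add hkψ)⟩

theorem monoCone_affine {φ : L1} (hφ : φ ∈ monoCone) {a : ℝ} (ha : 0 ≤ a) (b : ℝ) :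
    a • φ + b • one ∈ monoCone := by
  obtain ⟨g, hg, hgc, hgφ⟩ := hφ
  refine ⟨fun t => a * g t + b, fun s t hst => ?_, fun t => ?_, (coeFn_affine φ a b).trans ?_⟩
  · dsimp only
    gcongr
    exact hg hst
  · exact ((hgc t).const_mul a).add continuousWithinAt_const
  · filter_upwards [hgφ] with t h
    rw [h]

theorem monoCone_smul {φ : L1} (hφ : φ ∈ monoCone) {a : ℝ} (ha : 0 ≤ a) : a • φ ∈ monoCone := by
  simpa using monoCone_affine hφ ha 0

theorem zero_mem_monoCone : (0 : L1) ∈ monoCone := by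
  simpa using monoCone_smul (step_mem 0) le_rfl

theorem one_mem_monoCone : one ∈ monoCone := by
  simpa using monoCone_affine zero_mem_monoCone zero_le_one 1

theorem comonotonic_of_mem_monoCone {φ ψ : L1} (hφ : φ ∈ monoCone) (hψ : ψ ∈ monoCone) :
    Comonotonic φ ψ := by
  obtain ⟨g, hg, -, hgφ⟩ := hφ
  obtain ⟨k, hk, -, hkψ⟩ := hψ
  have h1 := Measure.quasiMeasurePreserving_fst (μ := (volume : Measure unitInterval))
    (ν := (volume : Measure unitInterval))
  have h2 := Measure.quasiMeasurePreserving_snd (μ := (volume : Measure unitInterval))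
    (ν := (volume : Measure unitInterval))
  filter_upwards [h1.ae hgφ, h1.ae hkψ, h2.ae hgφ, h2.ae hkψ] with p e1 e2 e3 e4
  rw [e1, e2, e3, e4]
  rcases le_total p.1 p.2 with h | h
  · exact mul_nonneg_of_nonpos_of_nonpos (sub_nonpos.2 (hg h)) (sub_nonpos.2 (hk h))
  · exact mul_nonneg (sub_nonneg.2 (hg h)) (sub_nonneg.2 (hk h))

/-! ### Extension from a cone and representation -/

/-- An additive, positively homogeneous and Lipschitz function on a convex cone extends to a
continuous linear functional. -/
theorem exists_extension_of_cone {E : Type*} [NormedAddCommGroup E] [NormedSpace ℝ E] {C : Set E}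
    (h0 : 0 ∈ C) (hadd : ∀ x ∈ C, ∀ y ∈ C, x + y ∈ C)
    (hsmul : ∀ x ∈ C, ∀ a : ℝ, 0 ≤ a → a • x ∈ C) {f : E → ℝ}
    (fadd : ∀ x ∈ C, ∀ y ∈ C, f (x + y) = f x + f y)
    (fsmul : ∀ x ∈ C, ∀ a : ℝ, 0 ≤ a → f (a • x) = a * f x) {M : ℝ}
    (flip : ∀ x ∈ C, ∀ y ∈ C, |f x - f y| ≤ M * ‖x - y‖) :
    ∃ F : E →L[ℝ] ℝ, ∀ x ∈ C, F x = f x := by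
  let S : Submodule ℝ E :=
    { carrier := {z | ∃ x ∈ C, ∃ y ∈ C, z = x - y}
      zero_mem' := ⟨0, h0, 0, h0, by simp⟩
      add_mem' := by
        rintro _ _ ⟨x, hx, y, hy, rfl⟩ ⟨x', hx', y', hy', rfl⟩
        exact ⟨x + x', hadd _ hx _ hx', y + y', hadd _ hy _ hy', by abel⟩
      smul_mem' := by
        rintro c _ ⟨x, hx, y, hy, rfl⟩
        rcases le_total 0 c with hc | hc
        · exact ⟨c • x, hsmul _ hx _ hc, c • y, hsmul _ hy _ hc, smul_sub _ _ _⟩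
        · exact ⟨-c • y, hsmul _ hy _ (neg_nonneg.2 hc), -c • x, hsmul _ hx _ (neg_nonneg.2 hc),
            by module⟩ }
  have hS : ∀ z : S, ∃ x ∈ C, ∃ y ∈ C, (z : E) = x - y := fun z => z.2
  choose p hp q hq hpq using hS
  -- The value does not depend on the chosen decomposition: if `p - q = x - y`, apply additivity to
  -- `p + y = x + q`.
  have key : ∀ (z : S), ∀ x ∈ C, ∀ y ∈ C, (z : E) = x - y → f (p z) - f (q z) = f x - f y := by
    intro z x hx y hy h
    have h1 : p z + y = x + q z := by
      rw [hpq z] at h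
      rw [← sub_eq_zero] at h ⊢
      rw [← h]; abel
    have h2 := congrArg f h1
    rw [fadd _ (hp z) _ hy, fadd _ hx _ (hq z)] at h2
    linarith
  let L : S →ₗ[ℝ] ℝ :=
    { toFun := fun z => f (p z) - f (q z)
      map_add' := fun z w => by
        rw [key (z + w) _ (hadd _ (hp z) _ (hp w)) _ (hadd _ (hq z) _ (hq w)) (by
          rw [Submodule.coe_add, hpq z, hpq w]; abel), fadd _ (hp z) _ (hp w),
          fadd _ (hq z) _ (hq w)]
        ring
      map_smul' := fun c z => by
        rw [RingHom.id_apply, smul_eq_mul]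
        rcases le_total 0 c with hc | hc
        · rw [key (c • z) _ (hsmul _ (hp z) _ hc) _ (hsmul _ (hq z) _ hc) (by
            rw [Submodule.coe_smul, hpq z, smul_sub]), fsmul _ (hp z) _ hc, fsmul _ (hq z) _ hc]
          ring
        · have hc' := neg_nonneg.2 hc
          rw [key (c • z) _ (hsmul _ (hq z) _ hc') _ (hsmul _ (hp z) _ hc') (by
            rw [Submodule.coe_smul, hpq z]; module), fsmul _ (hp z) _ hc', fsmul _ (hq z) _ hc']
          ring }
  -- The Lipschitz estimate on the cone is exactly an operator bound on differences.
  let G : StrongDual ℝ S := L.mkContinuous M fun z => by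
    rw [Real.norm_eq_abs, Submodule.coe_norm, hpq z]
    exact flip _ (hp z) _ (hq z)
  obtain ⟨F, hF, -⟩ := exists_extension_norm_eq S G
  refine ⟨F, fun x hx => ?_⟩
  have hxS : x ∈ S := ⟨x, hx, 0, h0, by simp⟩
  have hf0 : f 0 = 0 := by simpa using fsmul 0 h0 0 le_rfl
  refine (hF ⟨x, hxS⟩).trans ((key ⟨x, hxS⟩ x hx 0 h0 (by simp)).trans (by rw [hf0, sub_zero]))

theorem step_anti {a b : unitInterval} (hab : a ≤ b) : step b ≤ᵐ[volume] step a := by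
  filter_upwards [indicatorConstLp_coeFn (p := 1) (hs := measurableSet_Ioi (a := a))
      (hμs := measure_ne_top volume _) (c := (1 : ℝ)),
    indicatorConstLp_coeFn (p := 1) (hs := measurableSet_Ioi (a := b))
      (hμs := measure_ne_top volume _) (c := (1 : ℝ))] with t h1 h2
  rw [step, step, h1, h2]
  exact indicator_le_indicator_of_subset (Ioi_subset_Ioi hab) (fun _ => zero_le_one) t

theorem mem_densities_of_pairing {ν : Linfty} (h1 : pairing ν one = 1)
    (h2 : ∀ a b : unitInterval, a ≤ b → pairing ν (step b) ≤ pairing ν (step a)) :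
    ν ∈ densities := by
  refine ⟨?_, (pairing_one ν).symm.trans h1⟩
  have h3 : (0 : Linfty) ≤ᵐ[volume] ν := Linfty_le_of_step fun a b hab => by
    simpa [pairing] using h2 a b hab
  exact (Lp.coeFn_zero ℝ ∞ volume).symm.le.trans h3

theorem AffineInvariantOn.map_smul {D : Set L1} {f : L1 → ℝ} (hf : AffineInvariantOn D f)
    {φ : L1} (hφ : φ ∈ D) {a : ℝ} (ha : 0 ≤ a) : f (a • φ) = a * f φ := by
  simpa using hf φ hφ a 0 ha

theorem AffineInvariantOn.map_one {D : Set L1} {f : L1 → ℝ} (hf : AffineInvariantOn D f)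
    (h0 : 0 ∈ D) : f one = 1 := by
  simpa using hf 0 h0 0 1 le_rfl

/-- Representation of additive functions on a cone which contains the step functions. -/
theorem existsUnique_density {D : Set L1} (hD : monoCone ⊆ D)
    (hadd : ∀ x ∈ D, ∀ y ∈ D, x + y ∈ D) (hsmul : ∀ x ∈ D, ∀ a : ℝ, 0 ≤ a → a • x ∈ D)
    {f : L1 → ℝ} (f1 : AffineInvariantOn D f) (f2 : PointwiseMonotoneOn D f)
    (f3 : ∀ x ∈ D, ∀ y ∈ D, f (x + y) = f x + f y) (f5 : L1LipschitzOn D f) :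
    ∃! ν : Linfty, ν ∈ densities ∧ ∀ φ ∈ D, f φ = ∫ t, φ t * ν t := by
  obtain ⟨M, -, hM⟩ := f5
  obtain ⟨F, hF⟩ := exists_extension_of_cone (hD zero_mem_monoCone) hadd hsmul f3
    (fun x hx a ha => f1.map_smul hx ha) hM
  obtain ⟨ν, hν⟩ := exists_Linfty_repr F
  have hp : ∀ φ ∈ D, pairing ν φ = f φ := fun φ hφ => by rw [pairing_apply, ← hν, hF φ hφ]
  refine ⟨ν, ⟨mem_densities_of_pairing ?_ fun a b hab => ?_, fun φ hφ => ?_⟩, ?_⟩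
  · rw [hp _ (hD one_mem_monoCone), f1.map_one (hD zero_mem_monoCone)]
  · rw [hp _ (hD (step_mem _)), hp _ (hD (step_mem _))]
    exact f2 _ (hD (step_mem _)) _ (hD (step_mem _)) (step_anti hab)
  · rw [← hp φ hφ, pairing_apply]
  · rintro ν' ⟨-, h⟩
    refine Linfty_ext_of_step fun s => ?_
    rw [hp _ (hD (step_mem s)), h _ (hD (step_mem s)), pairing_apply]

theorem properties_of_density {D : Set L1} (hadd : ∀ x ∈ D, ∀ y ∈ D, x + y ∈ D)
    (haff : ∀ x ∈ D, ∀ a b : ℝ, 0 ≤ a → a • x + b • one ∈ D)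
    {f : L1 → ℝ} {ν : Linfty} (hν : ν ∈ densities) (hf : ∀ φ ∈ D, f φ = ∫ t, φ t * ν t) :
    AffineInvariantOn D f ∧ PointwiseMonotoneOn D f ∧
      (∀ x ∈ D, ∀ y ∈ D, f (x + y) = f x + f y) ∧ L1LipschitzOn D f := by
  have hp : ∀ φ ∈ D, f φ = pairing ν φ := fun φ hφ => by rw [pairing_apply, hf φ hφ]
  -- The `+ 1` keeps the Lipschitz constant strictly positive.
  refine ⟨fun φ hφ a b ha => ?_, fun φ hφ ψ hψ h => ?_, fun φ hφ ψ hψ => ?_,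
    ‖pairing ν‖ + 1, by positivity, fun φ hφ ψ hψ => ?_⟩
  · rw [hp _ (haff φ hφ a b ha), hp _ hφ, map_add, map_smul, map_smul, pairing_one, hν.2]
    simp
  · rw [hf _ hφ, hf _ hψ]
    refine integral_mono_ae (integrable_mul_Linfty (integrable_L1 φ) ν)
      (integrable_mul_Linfty (integrable_L1 ψ) ν) ?_
    filter_upwards [h, hν.1] with t h1 h2
    exact mul_le_mul_of_nonneg_right h1 h2
  · rw [hp _ hφ, hp _ hψ, hp _ (hadd _ hφ _ hψ), map_add]
  · rw [hp _ hφ, hp _ hψ, ← map_sub, ← Real.norm_eq_abs]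
    refine ((pairing ν).le_opNorm _).trans ?_
    gcongr
    linarith

theorem existsUnique_density_on_monoCone {f : L1 → ℝ} (f1 : AffineInvariantOn monoCone f)
    (f2 : PointwiseMonotoneOn monoCone f) (f3 : ComonotonicAdditiveOn monoCone f)
    (f5 : L1LipschitzOn monoCone f) :
    ∃! ν : Linfty, ν ∈ densities ∧ ∀ φ ∈ monoCone, f φ = ∫ t, φ t * ν t :=
  existsUnique_density Subset.rfl (fun _ hx _ hy => monoCone_add hx hy)
    (fun _ hx _ ha => monoCone_smul hx ha) f1 f2
    (fun x hx y hy => f3 x hx y hy (comonotonic_of_mem_monoCone hx hy)) f5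

theorem existsUnique_density_on_monoCone_of_univ {f : L1 → ℝ} (f1 : AffineInvariantOn univ f)
    (f2 : PointwiseMonotoneOn univ f) (f3 : ComonotonicAdditiveOn univ f)
    (f5 : L1LipschitzOn univ f) :
    ∃! ν : Linfty, ν ∈ densities ∧ ∀ φ ∈ monoCone, f φ = ∫ t, φ t * ν t :=
  existsUnique_density_on_monoCone (fun φ _ => f1 φ trivial)
    (fun φ _ ψ _ => f2 φ trivial ψ trivial) (fun φ _ ψ _ => f3 φ trivial ψ trivial)
    (f5.imp fun _ h => ⟨h.1, fun φ _ ψ _ => h.2 φ trivial ψ trivial⟩)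

theorem existsUnique_density_on_univ {f : L1 → ℝ} (f1 : AffineInvariantOn univ f)
    (f2 : PointwiseMonotoneOn univ f) (f3 : FullyAdditive f) (f5 : L1LipschitzOn univ f) :
    ∃! ν : Linfty, ν ∈ densities ∧ ∀ φ : L1, f φ = ∫ t, φ t * ν t := by
  simpa using existsUnique_density (subset_univ monoCone) (fun _ _ _ _ => trivial)
    (fun _ _ _ _ => trivial) f1 f2 (fun x _ y _ => f3 x y) f5

/-! ### Distribution and quantile functions -/

/-- Distribution function of `φ`. -/
noncomputable def dist (φ : unitInterval → ℝ) (s : ℝ) : ℝ := volume.real {u | φ u ≤ s}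

theorem dist_mono (φ : unitInterval → ℝ) : Monotone (dist φ) := fun _ _ h =>
  measureReal_mono fun _ hu => le_trans hu h

theorem dist_nonneg (φ : unitInterval → ℝ) (s : ℝ) : 0 ≤ dist φ s := measureReal_nonneg

theorem dist_le_one (φ : unitInterval → ℝ) (s : ℝ) : dist φ s ≤ 1 := measureReal_le_one

theorem ofReal_le_volume_iff (φ : unitInterval → ℝ) (t s : ℝ) :
    ENNReal.ofReal t ≤ volume {u | φ u ≤ s} ↔ t ≤ dist φ s := by
  rw [dist, measureReal_def, ENNReal.ofReal_le_iff_le_toReal (measure_ne_top _ _)]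

theorem dist_eq_cdf {φ : unitInterval → ℝ} (hφ : Measurable φ) (s : ℝ) :
    dist φ s = ProbabilityTheory.cdf ((volume : Measure unitInterval).map φ) s := by
  have := Measure.isProbabilityMeasure_map (μ := (volume : Measure unitInterval)) hφ.aemeasurable
  rw [ProbabilityTheory.cdf_eq_real, map_measureReal_apply hφ measurableSet_Iic]
  rfl

theorem quantile_eq (φ : unitInterval → ℝ) (t : unitInterval) :
    quantile φ t = sInf {s | (t : ℝ) ≤ dist φ s} := by
  simp only [quantile, ofReal_le_volume_iff]

theorem quantile_congr {φ ψ : unitInterval → ℝ} (h : φ =ᵐ[volume] ψ) : quantile φ = quantile ψ := by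
  ext t
  simp only [quantile]
  congr 1
  ext s
  rw [mem_ofPred_eq, mem_ofPred_eq, measure_congr]
  filter_upwards [h] with u hu
  exact propext (show φ u ≤ s ↔ ψ u ≤ s by rw [hu])

theorem quantile_comp_measurePreserving {φ : unitInterval → ℝ} (hφ : Measurable φ)
    {T : unitInterval → unitInterval} (hT : MeasurePreserving T volume volume) :
    quantile (φ ∘ T) = quantile φ := by
  ext t
  simp only [quantile]
  congr 1
  ext s
  have hs : MeasurableSet {u | φ u ≤ s} := hφ measurableSet_Iic
  rw [mem_ofPred_eq, mem_ofPred_eq, ← hT.measure_preimage hs.nullMeasurableSet]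
  rfl

theorem setOf_le_dist_nonempty {φ : unitInterval → ℝ} (hφ : Measurable φ) {t : ℝ} (ht : t < 1) :
    {s | t ≤ dist φ s}.Nonempty := by
  have h := ProbabilityTheory.tendsto_cdf_atTop ((volume : Measure unitInterval).map φ)
  obtain ⟨s, hs⟩ := (h.eventually_const_lt ht).exists
  exact ⟨s, by rw [mem_ofPred_eq, dist_eq_cdf hφ]; exact hs.le⟩

theorem setOf_le_dist_bddBelow {φ : unitInterval → ℝ} (hφ : Measurable φ) {t : ℝ} (ht : 0 < t) :
    BddBelow {s | t ≤ dist φ s} := by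
  have h := ProbabilityTheory.tendsto_cdf_atBot ((volume : Measure unitInterval).map φ)
  obtain ⟨s, hs⟩ := (h.eventually_lt_const ht).exists
  refine ⟨s, fun r hr => ?_⟩
  by_contra! hrs
  rw [← dist_eq_cdf hφ] at hs
  exact absurd (le_trans hr (dist_mono φ hrs.le)) (not_le.2 hs)

/-- Right continuity of the distribution function means the infimum is attained. This Galois
connection drives all later quantile estimates. -/
theorem quantile_le_iff {φ : unitInterval → ℝ} (hφ : Measurable φ) {t : unitInterval}
    (h0 : 0 < t) (h1 : t < 1) {s : ℝ} : quantile φ t ≤ s ↔ (t : ℝ) ≤ dist φ s := by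
  have hbdd := setOf_le_dist_bddBelow hφ (t := t) h0
  rw [quantile_eq]
  refine ⟨fun h => ?_, fun h => csInf_le hbdd h⟩
  have hc := (ProbabilityTheory.cdf ((volume : Measure unitInterval).map φ)).right_continuous s
  have hc' : Tendsto (dist φ) (𝓝[>] s) (𝓝 (dist φ s)) := by
    rw [show dist φ = _ from funext (dist_eq_cdf hφ)]
    exact hc.tendsto.mono_left (nhdsWithin_mono _ Ioi_subset_Ici_self)
  refine ge_of_tendsto hc' ?_
  filter_upwards [self_mem_nhdsWithin] with r (hr : s < r)
  obtain ⟨r', hr', hlt⟩ := exists_lt_of_csInf_lt (setOf_le_dist_nonempty hφ (t := t) h1)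
    (h.trans_lt hr)
  exact le_trans hr' (dist_mono φ hlt.le)

theorem ae_mem_Ioo : ∀ᵐ t : unitInterval, 0 < t ∧ t < 1 := by
  have h0 : ∀ᵐ t : unitInterval, t ≠ 0 := by simp [ae_iff]
  have h1 : ∀ᵐ t : unitInterval, t ≠ 1 := by simp [ae_iff]
  filter_upwards [h0, h1] with t h0 h1
  exact ⟨unitInterval.pos_iff_ne_zero.2 h0, unitInterval.lt_one_iff_ne_one.2 h1⟩

theorem quantile_le_quantile {φ ψ : unitInterval → ℝ} (hφ : Measurable φ) (hψ : Measurable ψ)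
    (h : φ ≤ᵐ[volume] ψ) {t : unitInterval} (h0 : 0 < t) (h1 : t < 1) :
    quantile φ t ≤ quantile ψ t := by
  rw [quantile_le_iff hφ h0 h1]
  refine ((quantile_le_iff hψ h0 h1).1 le_rfl).trans ?_
  refine ENNReal.toReal_mono (measure_ne_top _ _) (measure_mono_ae ?_)
  filter_upwards [h] with u hu hu'
  exact le_trans hu hu'

theorem monotoneOn_quantile {φ : unitInterval → ℝ} (hφ : Measurable φ) :
    MonotoneOn (quantile φ) (Ioo 0 1) := by
  intro s hs t ht hst
  rw [quantile_le_iff hφ hs.1 hs.2]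
  exact le_trans hst ((quantile_le_iff hφ ht.1 ht.2).1 le_rfl)

theorem measurable_quantile {φ : unitInterval → ℝ} (hφ : Measurable φ) :
    Measurable (quantile φ) := by
  refine measurable_of_Iic fun s => ?_
  have h1 : MeasurableSet (quantile φ ⁻¹' Iic s ∩ Ioo 0 1) := by
    have : quantile φ ⁻¹' Iic s ∩ Ioo 0 1 = {t : unitInterval | (t : ℝ) ≤ dist φ s} ∩ Ioo 0 1 := by
      ext t
      simp only [mem_inter_iff, mem_preimage, mem_Iic, mem_ofPred_eq, and_congr_left_iff]
      exact fun ht => quantile_le_iff hφ ht.1 ht.2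
    rw [this]
    exact (measurableSet_le measurable_subtype_coe measurable_const).inter measurableSet_Ioo
  -- The endpoint values are uncontrolled but account for at most two points.
  have h2 : (quantile φ ⁻¹' Iic s ∩ (Ioo 0 1)ᶜ).Finite := by
    refine (Set.toFinite {(0 : unitInterval), 1}).subset fun t ht => ?_
    by_contra h
    simp only [mem_insert_iff, mem_singleton_iff, not_or] at h
    exact ht.2 ⟨unitInterval.pos_iff_ne_zero.2 h.1, unitInterval.lt_one_iff_ne_one.2 h.2⟩
  rw [← inter_union_compl (quantile φ ⁻¹' Iic s) (Ioo 0 1)]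
  exact h1.union h2.measurableSet

/-- By the Galois connection, `{quantile φ ≤ s}` is, up to endpoints, an initial interval of length
`dist φ s`. -/
theorem map_quantile {φ : unitInterval → ℝ} (hφ : Measurable φ) :
    (volume : Measure unitInterval).map (quantile φ) = volume.map φ := by
  have := Measure.isProbabilityMeasure_map (μ := (volume : Measure unitInterval)) hφ.aemeasurable
  refine Measure.ext_of_Iic _ _ fun s => ?_
  rw [Measure.map_apply (measurable_quantile hφ) measurableSet_Iic,
    Measure.map_apply hφ measurableSet_Iic]
  have h1 : (quantile φ ⁻¹' Iic s : Set unitInterval) =ᵐ[volume]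
      Iic (⟨dist φ s, dist_nonneg φ s, dist_le_one φ s⟩ : unitInterval) := by
    filter_upwards [ae_mem_Ioo] with t ht
    exact propext (quantile_le_iff hφ ht.1 ht.2)
  rw [measure_congr h1, unitInterval.volume_Iic]
  exact ofReal_measureReal

theorem integrable_quantile {φ : unitInterval → ℝ} (hφ : Measurable φ) (hi : Integrable φ) :
    Integrable (quantile φ) := by
  have h : Integrable id ((volume : Measure unitInterval).map φ) :=
    (integrable_map_measure aestronglyMeasurable_id hφ.aemeasurable).2 hi
  rw [← map_quantile hφ] at h
  exact (integrable_map_measure aestronglyMeasurable_id (measurable_quantile hφ).aemeasurable).1 h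

theorem integral_quantile {φ : unitInterval → ℝ} (hφ : Measurable φ) :
    ∫ t, quantile φ t = ∫ t, φ t := by
  have h := congrArg (fun μ : Measure ℝ => ∫ x, id x ∂μ) (map_quantile hφ)
  exact (integral_map (measurable_quantile hφ).aemeasurable aestronglyMeasurable_id).symm.trans
    (h.trans (integral_map hφ.aemeasurable aestronglyMeasurable_id))

/-! ### The rank map -/

/-- The measure of the set of points preceding `u` in the order by the value of `χ`, with ties
broken by position. -/
noncomputable def rank (χ : unitInterval → ℝ) (u : unitInterval) : unitInterval :=
  ⟨volume.real {v | χ v < χ u ∨ χ v = χ u ∧ v ≤ u}, measureReal_nonneg, measureReal_le_one⟩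

theorem measurable_rank {χ : unitInterval → ℝ} (hχ : Measurable χ) : Measurable (rank χ) := by
  refine Measurable.subtype_mk (Measurable.ennreal_toReal ?_)
  have hE : MeasurableSet {p : unitInterval × unitInterval |
      χ p.2 < χ p.1 ∨ χ p.2 = χ p.1 ∧ p.2 ≤ p.1} :=
    (measurableSet_lt (hχ.comp measurable_snd) (hχ.comp measurable_fst)).union
      ((measurableSet_eq_fun (hχ.comp measurable_snd) (hχ.comp measurable_fst)).inter
        (measurableSet_le (α := unitInterval) measurable_snd measurable_fst))
  exact measurable_measure_prodMk_left hE

/-- The least point of `{c ≤ h}` works even when `h` has plateaus. -/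
theorem exists_lt_iff_of_monotone {h : unitInterval → ℝ} (hc : Continuous h) (hm : Monotone h)
    {c : ℝ} (h0 : h 0 ≤ c) (h1 : c ≤ h 1) : ∃ r, h r = c ∧ ∀ u, h u < c ↔ u < r := by
  obtain ⟨r, hr, hmin⟩ := (isClosed_le continuous_const hc).isCompact.exists_isLeast
    (s := {u | c ≤ h u}) ⟨1, h1⟩
  refine ⟨r, le_antisymm ?_ hr, fun u => ?_⟩
  · obtain ⟨r', hr', hcr⟩ := intermediate_value_Icc (unitInterval.nonneg' (t := r))
      hc.continuousOn ⟨h0, hr⟩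
    rw [le_antisymm (hmin hcr.ge) hr'.2, hcr]
  · rw [← not_le, ← not_le, not_iff_not]
    exact ⟨fun h => hmin h, fun h => le_trans hr (hm h)⟩

theorem continuous_measureReal_inter_Iic (A : Set unitInterval) :
    Continuous fun u => volume.real (A ∩ Iic u) := by
  refine (LipschitzWith.of_le_add_mul 1 fun u v => ?_).continuous
  have h : A ∩ Iic u ⊆ (A ∩ Iic v) ∪ Ioc v u := by
    rintro w ⟨hw, hwu⟩
    rcases le_or_gt w v with h | h
    · exact Or.inl ⟨hw, h⟩
    · exact Or.inr ⟨h, hwu⟩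
  refine (measureReal_mono h).trans ((measureReal_union_le _ _).trans ?_)
  gcongr
  rw [measureReal_def, unitInterval.volume_Ioc, NNReal.coe_one, one_mul, Subtype.dist_eq,
    Real.dist_eq]
  rw [ENNReal.toReal_ofReal']
  exact max_le (le_abs_self _) (abs_nonneg _)

theorem measureReal_lt_quantile_le {χ : unitInterval → ℝ} (hχ : Measurable χ) {t : unitInterval}
    (h0 : 0 < t) (h1 : t < 1) : volume.real {u | χ u < quantile χ t} ≤ t := by
  obtain ⟨s, hs, hlt, hlim⟩ := exists_seq_strictMono_tendsto (quantile χ t)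
  have hU : {u | χ u < quantile χ t} = ⋃ n, {u | χ u ≤ s n} := by
    have := congrArg (χ ⁻¹' ·) (iUnion_Iic_eq_Iio_of_lt_of_tendsto hlt hlim)
    simp only [preimage_iUnion] at this
    exact this.symm
  have hmono : Monotone fun n => {u | χ u ≤ s n} := fun n m hnm u hu =>
    le_trans hu (hs.monotone hnm)
  rw [hU]
  refine le_of_tendsto ((ENNReal.tendsto_toReal (measure_ne_top _ _)).comp
    (tendsto_measure_iUnion_atTop hmono)) (.of_forall fun n => ?_)
  have := (quantile_le_iff hχ h0 h1 (s := s n)).not.1 (not_le.2 (hlt n))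
  exact (not_le.1 this).le

/-- Let `q` be the quantile at `t`. Points with `χ < q` have rank below `t`, points with `χ > q` do
not. The possible atom `{χ = q}` is cut by position at `r`, chosen so that its left part supplies
exactly the missing mass. -/
theorem measureReal_rank_lt {χ : unitInterval → ℝ} (hχ : Measurable χ) {t : unitInterval}
    (h0 : 0 < t) (h1 : t < 1) : volume.real {u | rank χ u < t} = t := by
  set q := quantile χ t
  have hq : (t : ℝ) ≤ dist χ q := (quantile_le_iff hχ h0 h1).1 le_rfl
  have hq' : volume.real {u | χ u < q} ≤ t := measureReal_lt_quantile_le hχ h0 h1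
  have hlow : ∀ s < q, dist χ s < t := fun s hs =>
    not_le.1 ((quantile_le_iff hχ h0 h1).not.1 (not_le.2 hs))
  let A := {u | χ u = q}
  have hA : MeasurableSet A := hχ (measurableSet_singleton q)
  have hsplit : ∀ B, MeasurableSet B → volume.real ({u | χ u < q} ∪ (A ∩ B)) =
      volume.real {u | χ u < q} + volume.real (A ∩ B) := fun B hB =>
    measureReal_union (disjoint_left.2 fun u h1 h2 => (ne_of_lt h1) h2.1) (hA.inter hB)
  obtain ⟨r, hr, hlt⟩ := exists_lt_iff_of_monotone (continuous_measureReal_inter_Iic A)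
    (fun u v huv => measureReal_mono (inter_subset_inter_right _ (Iic_subset_Iic.2 huv)))
    (c := t - volume.real {u | χ u < q}) (by
      have : volume.real (A ∩ Iic 0) ≤ volume.real (Iic (0 : unitInterval)) :=
        measureReal_mono inter_subset_right
      rw [measureReal_def (s := Iic 0), unitInterval.volume_Iic] at this
      simp only [Icc.coe_zero, ENNReal.ofReal_zero, ENNReal.toReal_zero] at this
      linarith) (by
      have h2 := hsplit _ (measurableSet_Iic (a := (1 : unitInterval)))
      have h3 : {u | χ u < q} ∪ (A ∩ Iic 1) = {u | χ u ≤ q} := by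
        ext u
        simp [A, le_iff_lt_or_eq (a := χ u), unitInterval.le_one']
      rw [h3] at h2
      rw [dist] at hq
      linarith)
  have hset : {u | rank χ u < t} = {u | χ u < q} ∪ (A ∩ Iio r) := by
    ext u
    simp only [mem_ofPred_eq, mem_union, mem_inter_iff, mem_Iio]
    rw [← Subtype.coe_lt_coe]
    change volume.real {v | χ v < χ u ∨ χ v = χ u ∧ v ≤ u} < _ ↔ _
    rcases lt_trichotomy (χ u) q with h | h | h
    · simp only [h, true_or, iff_true]
      refine lt_of_le_of_lt (measureReal_mono ?_) (hlow _ h)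
      rintro v (hv | hv)
      · exact hv.le
      · exact hv.1.le
    · have hu : u ∈ A := h
      simp only [hu, h, lt_irrefl, false_or, true_and]
      rw [← hlt u, lt_sub_iff_add_lt', ← hsplit _ measurableSet_Iic]
      rfl
    · have hu : u ∉ A := h.ne'
      simp only [hu, h.not_gt, false_and, or_self, iff_false, not_lt]
      exact hq.trans (measureReal_mono fun v hv => Or.inl (lt_of_le_of_lt hv h))
  have hAr : volume.real (A ∩ Iio r) = volume.real (A ∩ Iic r) :=
    measureReal_congr ((ae_eq_refl A).inter Iio_ae_eq_Iic)
  rw [hset, hsplit _ measurableSet_Iio, hAr, hr]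
  ring

theorem measurePreserving_rank {χ : unitInterval → ℝ} (hχ : Measurable χ) :
    MeasurePreserving (rank χ) volume volume := by
  have hm := measurable_rank hχ
  refine ⟨hm, ?_⟩
  have := Measure.isProbabilityMeasure_map (μ := (volume : Measure unitInterval)) hm.aemeasurable
  have hlt : ∀ t : unitInterval, volume.real {u | rank χ u < t} = t := by
    intro t
    rcases (unitInterval.nonneg' (t := t)).eq_or_lt with rfl | h0
    · simp [unitInterval.nonneg'.not_gt]
    rcases (unitInterval.le_one' (t := t)).eq_or_lt with rfl | h1
    -- At `t = 1` the previous lemma does not apply; approximate by levels `d < 1`.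
    · refine le_antisymm measureReal_le_one (le_of_forall_lt fun c hc => ?_)
      have hc' : max c 0 < 1 := max_lt hc zero_lt_one
      obtain ⟨d, hd, hd1⟩ := exists_between hc'
      have hd0 : 0 < d := (le_max_right _ _).trans_lt hd
      have := measureReal_rank_lt hχ (t := ⟨d, hd0.le, hd1.le⟩) hd0 hd1
      refine (((le_max_left _ _).trans_lt hd).trans_eq this.symm).trans_le (measureReal_mono ?_)
      exact fun u hu => lt_trans hu hd1
    · exact measureReal_rank_lt hχ h0 h1
  refine Measure.ext_of_Ici _ _ fun t => ?_
  rw [← compl_Iio, prob_compl_eq_one_sub measurableSet_Iio, prob_compl_eq_one_sub measurableSet_Iio,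
    Measure.map_apply hm measurableSet_Iio, unitInterval.volume_Iio, ← hlt t, ofReal_measureReal]
  rfl

/-- A function which is non-decreasing with respect to `χ` factors through its quantile function
and the rank map of `χ`. -/
theorem quantile_comp_rank {χ φ : unitInterval → ℝ} (hχ : Measurable χ) (hφ : Measurable φ)
    (hi : Integrable φ) (h : ∀ᵐ u, ∀ᵐ v, χ v ≤ χ u → φ v ≤ φ u) :
    quantile φ ∘ rank χ =ᵐ[volume] φ := by
  have hT := measurePreserving_rank hχ
  have hle : quantile φ ∘ rank χ ≤ᵐ[volume] φ := by
    -- Almost all points preceding `u` have `φ`-value at most `φ u`, so `rank χ u ≤ dist φ (φ u)`.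
    filter_upwards [hT.quasiMeasurePreserving.ae ae_mem_Ioo, h] with u hu hv
    rw [Function.comp_apply, quantile_le_iff hφ hu.1 hu.2]
    refine ENNReal.toReal_mono (measure_ne_top _ _) (measure_mono_ae ?_)
    filter_upwards [hv] with v hv hv'
    exact hv (hv'.elim le_of_lt fun h => h.1.le)
  -- Both sides have the same integral, which upgrades the inequality to equality.
  refine (integral_eq_iff_of_ae_le ?_ hi hle).1 ?_
  · exact (hT.integrable_comp (integrable_quantile hφ hi).aestronglyMeasurable).2
      (integrable_quantile hφ hi)
  · rw [← integral_quantile hφ]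
    have := integral_map (μ := volume) hT.measurable.aemeasurable (f := quantile φ)
      (measurable_quantile hφ).aestronglyMeasurable
    rw [hT.map_eq] at this
    exact this.symm

theorem quantile_comp_rank_self {φ : unitInterval → ℝ} (hφ : Measurable φ) (hi : Integrable φ) :
    quantile φ ∘ rank φ =ᵐ[volume] φ :=
  quantile_comp_rank hφ hφ hi (.of_forall fun _ => .of_forall fun _ h => h)

/-! ### Quantiles of compositions, sums and differences -/

theorem ae_eq_of_comp_measurePreserving {g k : unitInterval → ℝ} (hg : Measurable g)
    (hk : Measurable k) {T : unitInterval → unitInterval} (hT : MeasurePreserving T volume volume)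
    (h : g ∘ T =ᵐ[volume] k ∘ T) : g =ᵐ[volume] k := by
  have := (ae_map_iff hT.measurable.aemeasurable (measurableSet_eq_fun hg hk)).2 h
  rwa [hT.map_eq] at this

theorem quantile_monotone_comp {φ : unitInterval → ℝ} (hφ : Measurable φ) (hi : Integrable φ)
    {m : ℝ → ℝ} (hm : Monotone m) (hmi : Integrable (m ∘ φ)) :
    quantile (m ∘ φ) =ᵐ[volume] m ∘ quantile φ := by
  refine ae_eq_of_comp_measurePreserving (measurable_quantile (hm.measurable.comp hφ))
    (hm.measurable.comp (measurable_quantile hφ)) (measurePreserving_rank hφ) ?_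
  refine (quantile_comp_rank hφ (hm.measurable.comp hφ) hmi
    (.of_forall fun _ => .of_forall fun _ h => hm h)).trans ?_
  filter_upwards [quantile_comp_rank_self hφ hi] with u hu
  rw [Function.comp_apply, Function.comp_apply, Function.comp_apply, ← hu]
  rfl

/-- If the sum is no larger at `v` than at `u` but one summand is larger, the other is smaller,
against comonotonicity. So both summands, like the sum, factor through the rank map of the sum,
which can then be cancelled. -/
theorem quantile_add_of_comonotonic {φ ψ : unitInterval → ℝ} (hφ : Measurable φ)
    (hψ : Measurable ψ) (hφi : Integrable φ) (hψi : Integrable ψ)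
    (h : ∀ᵐ p : unitInterval × unitInterval ∂((volume : Measure unitInterval).prod volume),
      0 ≤ (φ p.1 - φ p.2) * (ψ p.1 - ψ p.2)) :
    quantile (φ + ψ) =ᵐ[volume] quantile φ + quantile ψ := by
  have hχ := hφ.add hψ
  have hae := Measure.ae_ae_of_ae_prod h
  have e1 := quantile_comp_rank hχ hφ hφi <| by
    filter_upwards [hae] with u hu
    filter_upwards [hu] with v hv hle
    by_contra! hlt
    simp only [Pi.add_apply] at hle
    exact absurd hv (not_le.2 (mul_neg_of_neg_of_pos (by linarith) (by linarith)))
  have e2 := quantile_comp_rank hχ hψ hψi <| by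
    filter_upwards [hae] with u hu
    filter_upwards [hu] with v hv hle
    by_contra! hlt
    simp only [Pi.add_apply] at hle
    exact absurd hv (not_le.2 (mul_neg_of_pos_of_neg (by linarith) (by linarith)))
  refine ae_eq_of_comp_measurePreserving (measurable_quantile hχ)
    ((measurable_quantile hφ).add (measurable_quantile hψ)) (measurePreserving_rank hχ) ?_
  refine (quantile_comp_rank_self hχ (hφi.add hψi)).trans (e1.add e2).symm

theorem quantile_of_monotone {g : unitInterval → ℝ} (hg : Monotone g) (hi : Integrable g) :
    quantile g =ᵐ[volume] g := by
  have hle : quantile g ≤ᵐ[volume] g := by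
    filter_upwards [ae_mem_Ioo] with t ht
    rw [quantile_le_iff hg.measurable ht.1 ht.2, ← ofReal_le_volume_iff, ← unitInterval.volume_Iic]
    exact measure_mono fun u hu => hg hu
  exact (integral_eq_iff_of_ae_le (integrable_quantile hg.measurable hi) hi hle).1
    (integral_quantile hg.measurable)

/-- Passing to quantile functions is a contraction in `L¹`. -/
theorem integral_abs_quantile_sub_le {φ ψ : unitInterval → ℝ} (hφ : Measurable φ)
    (hψ : Measurable ψ) (hφi : Integrable φ) (hψi : Integrable ψ) :
    ∫ t, |quantile φ t - quantile ψ t| ≤ ∫ t, |φ t - ψ t| := by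
  -- `|φ - ψ|` is supremum minus infimum; quantiles preserve integrals and order, so both quantiles
  -- lie between those of the infimum and supremum.
  have hM := hφ.sup hψ
  have hm := hφ.inf hψ
  have hMi := hφi.sup hψi
  have hmi := hφi.inf hψi
  have h1 : ∫ t, |φ t - ψ t| = ∫ t, (quantile (φ ⊔ ψ) t - quantile (φ ⊓ ψ) t) := by
    rw [integral_sub (integrable_quantile hM hMi) (integrable_quantile hm hmi),
      integral_quantile hM, integral_quantile hm, ← integral_sub hMi hmi]
    refine integral_congr_ae (.of_forall fun t => ?_)
    simp only [Pi.sup_apply, Pi.inf_apply]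
    exact (max_sub_min_eq_abs' _ _).symm
  rw [h1]
  refine integral_mono_ae ((integrable_quantile hφ hφi).sub (integrable_quantile hψ hψi)).abs
    ((integrable_quantile hM hMi).sub (integrable_quantile hm hmi)) ?_
  filter_upwards [ae_mem_Ioo] with t ht
  have a1 := quantile_le_quantile hφ hM (.of_forall fun _ => le_sup_left) ht.1 ht.2
  have a2 := quantile_le_quantile hψ hM (.of_forall fun _ => le_sup_right) ht.1 ht.2
  have a3 := quantile_le_quantile hm hφ (.of_forall fun _ => inf_le_left) ht.1 ht.2
  have a4 := quantile_le_quantile hm hψ (.of_forall fun _ => inf_le_right) ht.1 ht.2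
  exact abs_sub_le_iff.2 ⟨by linarith, by linarith⟩

/-! ### Quantile rearrangement on `L¹` -/

theorem measurable_L1 (φ : L1) : Measurable φ := (Lp.stronglyMeasurable φ).measurable

theorem integrable_quantile_L1 (φ : L1) : Integrable (quantile φ) :=
  integrable_quantile (measurable_L1 φ) (integrable_L1 φ)

/-- The quantile function as an element of `L¹`. -/
noncomputable def quantileL1 (φ : L1) : L1 := (integrable_quantile_L1 φ).toL1

theorem coeFn_quantileL1 (φ : L1) : quantileL1 φ =ᵐ[volume] quantile φ :=
  (integrable_quantile_L1 φ).coeFn_toL1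

theorem integral_quantile_mul (φ : L1) (ν : Linfty) :
    ∫ t, quantile φ t * ν t = pairing ν (quantileL1 φ) := by
  rw [pairing_apply]
  apply integral_congr_ae
  filter_upwards [coeFn_quantileL1 φ] with t h
  rw [h]

theorem norm_sub_eq_integral (φ ψ : L1) : ‖φ - ψ‖ = ∫ t, |φ t - ψ t| := by
  rw [L1.norm_eq_integral_norm]
  apply integral_congr_ae
  filter_upwards [Lp.coeFn_sub φ ψ] with t h
  rw [h, Pi.sub_apply, Real.norm_eq_abs]

theorem norm_quantileL1_sub_le (φ ψ : L1) : ‖quantileL1 φ - quantileL1 ψ‖ ≤ ‖φ - ψ‖ := by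
  rw [norm_sub_eq_integral, norm_sub_eq_integral]
  refine le_trans (le_of_eq (integral_congr_ae ?_)) (integral_abs_quantile_sub_le
    (measurable_L1 φ) (measurable_L1 ψ) (integrable_L1 φ) (integrable_L1 ψ))
  filter_upwards [coeFn_quantileL1 φ, coeFn_quantileL1 ψ] with t h1 h2
  rw [h1, h2]

theorem quantileL1_affine (φ : L1) {a : ℝ} (ha : 0 ≤ a) (b : ℝ) :
    quantileL1 (a • φ + b • one) = a • quantileL1 φ + b • one := by
  apply Lp.ext
  have hm : Monotone fun x : ℝ => a * x + b := fun x y h => by dsimp only; gcongr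
  have h1 := quantile_monotone_comp (measurable_L1 φ) (integrable_L1 φ) hm
    (((integrable_L1 φ).const_mul a).add (integrable_const b))
  have h2 : quantile (a • φ + b • one : L1) = quantile ((fun x : ℝ => a * x + b) ∘ φ) :=
    quantile_congr (coeFn_affine φ a b)
  filter_upwards [h1, coeFn_affine (quantileL1 φ) a b, coeFn_quantileL1 (a • φ + b • one),
    coeFn_quantileL1 φ] with t h3 h4 h5 h6
  rw [h4, h5, h6, h2, h3]
  rfl

theorem quantileL1_mono {φ ψ : L1} (h : φ ≤ᵐ[volume] ψ) :
    quantileL1 φ ≤ᵐ[volume] quantileL1 ψ := by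
  filter_upwards [coeFn_quantileL1 φ, coeFn_quantileL1 ψ, ae_mem_Ioo] with t h1 h2 ht
  rw [h1, h2]
  exact quantile_le_quantile (measurable_L1 φ) (measurable_L1 ψ) h ht.1 ht.2

theorem quantileL1_add {φ ψ : L1} (h : Comonotonic φ ψ) :
    quantileL1 (φ + ψ) = quantileL1 φ + quantileL1 ψ := by
  apply Lp.ext
  have h1 := quantile_add_of_comonotonic (measurable_L1 φ) (measurable_L1 ψ) (integrable_L1 φ)
    (integrable_L1 ψ) h
  rw [← quantile_congr (Lp.coeFn_add φ ψ)] at h1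
  refine (coeFn_quantileL1 _).trans (h1.trans ?_)
  exact ((coeFn_quantileL1 φ).add (coeFn_quantileL1 ψ)).symm.trans (Lp.coeFn_add _ _).symm

theorem quantileL1_compMeasurePreserving (φ : L1) {T : unitInterval → unitInterval}
    (hT : MeasurePreserving T volume volume) :
    quantileL1 (Lp.compMeasurePreserving T hT φ) = quantileL1 φ := by
  apply Lp.ext
  refine (coeFn_quantileL1 _).trans (EventuallyEq.trans ?_ (coeFn_quantileL1 φ).symm)
  rw [quantile_congr (Lp.coeFn_compMeasurePreserving φ hT),
    quantile_comp_measurePreserving (measurable_L1 φ) hT]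

theorem quantileL1_of_mem_monoCone {φ : L1} (hφ : φ ∈ monoCone) : quantileL1 φ = φ := by
  obtain ⟨g, hg, -, hgφ⟩ := hφ
  apply Lp.ext
  refine (coeFn_quantileL1 φ).trans ?_
  rw [quantile_congr hgφ]
  exact (quantile_of_monotone hg ((integrable_L1 φ).congr hgφ)).trans hgφ.symm

/-- Every element of `L¹` is its quantile function composed with a measure preserving map. -/
theorem exists_compMeasurePreserving_quantileL1 (φ : L1) :
    ∃ (T : unitInterval → unitInterval) (hT : MeasurePreserving T volume volume),
      Lp.compMeasurePreserving T hT (quantileL1 φ) = φ := by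
  have hT := measurePreserving_rank (measurable_L1 φ)
  refine ⟨_, hT, Lp.ext ?_⟩
  exact (Lp.coeFn_compMeasurePreserving _ hT).trans
    ((hT.quasiMeasurePreserving.ae_eq_comp (coeFn_quantileL1 φ)).trans
      (quantile_comp_rank_self (measurable_L1 φ) (integrable_L1 φ)))

/-- Taking left limits alters `g` only at its countably many discontinuities. -/
theorem mem_monoCone_of_monotone {φ : L1} {g : unitInterval → ℝ} (hg : Monotone g)
    (h : φ =ᵐ[volume] g) : φ ∈ monoCone := by
  refine ⟨Function.leftLim g, hg.leftLim, fun t => ?_, h.trans ?_⟩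
  · exact continuousWithinAt_leftLim_Iic (hg.tendsto_leftLim t)
  · filter_upwards [hg.countable_not_continuousAt.ae_notMem volume] with t ht
    exact ((not_not.1 ht).continuousWithinAt.leftLim_eq).symm

/-- Truncation at the levels `-n` and `n`. -/
noncomputable def truncation (n : ℕ) (x : ℝ) : ℝ := max (-n) (min n x)

theorem monotone_truncation (n : ℕ) : Monotone (truncation n) := fun _ _ h =>
  max_le_max le_rfl (min_le_min le_rfl h)

theorem abs_truncation_le (n : ℕ) (x : ℝ) : |truncation n x| ≤ |x| := by
  have hn : (0 : ℝ) ≤ n := n.cast_nonneg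
  refine abs_le.2 ⟨?_, ?_⟩
  · rw [truncation, le_max_iff, le_min_iff]
    rcases le_total (-(n : ℝ)) x with h | h
    · exact Or.inr ⟨by linarith [abs_nonneg x], neg_abs_le x⟩
    · exact Or.inl (by linarith [neg_le_abs x])
  · exact max_le (by linarith [abs_nonneg x]) ((min_le_right _ _).trans (le_abs_self x))

theorem truncation_eq {n : ℕ} {x : ℝ} (h : |x| ≤ n) : truncation n x = x := by
  rw [truncation, min_eq_right (abs_le.1 h).2, max_eq_right (abs_le.1 h).1]

theorem integrable_truncation {g : unitInterval → ℝ} (hg : Integrable g) (n : ℕ) :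
    Integrable fun t => truncation n (g t) :=
  hg.mono ((monotone_truncation n).measurable.comp_aemeasurable hg.aemeasurable).aestronglyMeasurable
    (.of_forall fun t => abs_truncation_le n (g t))

/-- Quantiles may be unbounded near `0` and `1`, while the cone demands a real-valued monotone
function on all of `[0,1]`; boundedness allows a monotone extension. -/
theorem truncation_quantile_mem_monoCone (φ : L1) (n : ℕ) :
    (integrable_truncation (integrable_quantile_L1 φ) n).toL1 ∈ monoCone := by
  have hmono : MonotoneOn (fun t => truncation n (quantile φ t)) (Ioo 0 1) := fun s hs t ht hst =>
    monotone_truncation n (monotoneOn_quantile (measurable_L1 φ) hs ht hst)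
  obtain ⟨g, hg, hgeq⟩ := hmono.exists_monotone_extension
    ⟨-n, by rintro _ ⟨t, -, rfl⟩; exact le_max_left _ _⟩
    ⟨n, by
      rintro _ ⟨t, -, rfl⟩
      exact max_le (by linarith [n.cast_nonneg (α := ℝ)]) (min_le_left _ _)⟩
  refine mem_monoCone_of_monotone hg ((Integrable.coeFn_toL1 _).trans ?_)
  filter_upwards [ae_mem_Ioo] with t ht
  exact hgeq ht

theorem tendsto_truncation_toL1 {g : unitInterval → ℝ} (hg : Integrable g) :
    Tendsto (fun n => (integrable_truncation hg n).toL1) atTop (𝓝 (hg.toL1 : L1)) := by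
  rw [tendsto_iff_norm_sub_tendsto_zero]
  have h1 : ∀ n, ‖(integrable_truncation hg n).toL1 - (hg.toL1 : L1)‖ =
      ∫ t, |truncation n (g t) - g t| := fun n => by
    rw [norm_sub_eq_integral]
    apply integral_congr_ae
    filter_upwards [hg.coeFn_toL1, (integrable_truncation hg n).coeFn_toL1] with t h1 h2
    rw [h1, h2]
  simp only [h1]
  rw [← integral_zero unitInterval ℝ (μ := volume)]
  refine tendsto_integral_of_dominated_convergence (fun t => 2 * |g t|)
    (fun n => ((integrable_truncation hg n).sub hg).abs.aestronglyMeasurable)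
    (hg.abs.const_mul 2) (fun n => .of_forall fun t => ?_) (.of_forall fun t => ?_)
  · rw [Real.norm_eq_abs, abs_abs]
    refine (abs_sub _ _).trans ?_
    linarith [abs_truncation_le n (g t)]
  · refine tendsto_const_nhds.congr' ?_
    filter_upwards [eventually_ge_atTop ⌈|g t|⌉₊] with n hn
    rw [truncation_eq ((Nat.le_ceil _).trans (Nat.cast_le.2 hn)), sub_self, abs_zero]

/-! ### Permutation-invariant functionals -/

theorem L1LipschitzOn.continuous {f : L1 → ℝ} (hf : L1LipschitzOn univ f) : Continuous f := by
  obtain ⟨M, hM, h⟩ := hf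
  refine (LipschitzWith.of_dist_le_mul (K := M.toNNReal) fun φ ψ => ?_).continuous
  rw [Real.dist_eq, dist_eq_norm, Real.coe_toNNReal _ hM.le]
  exact h φ trivial ψ trivial

theorem eq_pairing_quantileL1 {f : L1 → ℝ} (f4 : StronglyPermutationInvariant f)
    (f5 : L1LipschitzOn univ f) {ν : Linfty} (hν : ∀ φ ∈ monoCone, f φ = ∫ t, φ t * ν t)
    (φ : L1) : f φ = pairing ν (quantileL1 φ) := by
  obtain ⟨T, hT, hφ⟩ := exists_compMeasurePreserving_quantileL1 φ
  have h1 : f φ = f (quantileL1 φ) := by rw [f4 T hT (quantileL1 φ), hφ]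
  have h2 := tendsto_truncation_toL1 (integrable_quantile_L1 φ)
  have h3 := (f5.continuous.tendsto _).comp h2
  have h4 := ((pairing ν).continuous.tendsto _).comp h2
  rw [h1]
  refine tendsto_nhds_unique h3 (h4.congr fun n => ?_)
  rw [Function.comp_apply, Function.comp_apply, pairing_apply,
    hν _ (truncation_quantile_mem_monoCone φ n)]

theorem existsUnique_quantile_density {f : L1 → ℝ} (f1 : AffineInvariantOn univ f)
    (f2 : PointwiseMonotoneOn univ f) (f3 : ComonotonicAdditiveOn univ f)
    (f4 : StronglyPermutationInvariant f) (f5 : L1LipschitzOn univ f) :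
    ∃! ν : Linfty, ν ∈ densities ∧ ∀ φ : L1, Integrable (fun t => quantile φ t * ν t) ∧
      f φ = ∫ t, quantile φ t * ν t := by
  obtain ⟨ν, ⟨hν, hf⟩, -⟩ := existsUnique_density_on_monoCone_of_univ f1 f2 f3 f5
  have hrep := eq_pairing_quantileL1 f4 f5 hf
  refine ⟨ν, ⟨hν, fun φ => ⟨integrable_mul_Linfty (integrable_quantile_L1 φ) ν, ?_⟩⟩, ?_⟩
  · rw [integral_quantile_mul, hrep]
  · rintro ν' ⟨-, h⟩
    refine Linfty_ext_of_step fun s => ?_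
    have h1 := (h (step s)).2
    rwa [integral_quantile_mul, hrep, quantileL1_of_mem_monoCone (step_mem s), eq_comm] at h1

theorem properties_of_quantile_density {f : L1 → ℝ} {ν : Linfty} (hν : ν ∈ densities)
    (hf : ∀ φ : L1, f φ = ∫ t, quantile φ t * ν t) :
    AffineInvariantOn univ f ∧ PointwiseMonotoneOn univ f ∧ ComonotonicAdditiveOn univ f ∧
      StronglyPermutationInvariant f ∧ L1LipschitzOn univ f := by
  have hrep : ∀ φ, f φ = pairing ν (quantileL1 φ) := fun φ => by
    rw [hf, integral_quantile_mul]
  obtain ⟨g1, g2, g3, M, hM, g5⟩ := properties_of_density (D := univ) (f := pairing ν)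
    (fun _ _ _ _ => trivial) (fun _ _ _ _ _ => trivial) hν (fun φ _ => pairing_apply ν φ)
  refine ⟨fun φ _ a b ha => ?_, fun φ _ ψ _ h => ?_, fun φ _ ψ _ h => ?_, fun T hT φ => ?_,
    M, hM, fun φ _ ψ _ => ?_⟩
  · rw [hrep, hrep, quantileL1_affine φ ha, g1 _ trivial a b ha]
  · rw [hrep, hrep]
    exact g2 _ trivial _ trivial (quantileL1_mono h)
  · rw [hrep, hrep, hrep, quantileL1_add h, map_add]
  · rw [hrep, hrep, quantileL1_compMeasurePreserving]
  · rw [hrep, hrep]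
    exact (g5 _ trivial _ trivial).trans
      (mul_le_mul_of_nonneg_left (norm_quantileL1_sub_le φ ψ) hM.le)

/-! ### Rigidity under full additivity -/

theorem integral_comp_measurePreserving {g : unitInterval → ℝ} (hg : AEStronglyMeasurable g)
    {T : unitInterval → unitInterval} (hT : MeasurePreserving T volume volume) :
    ∫ t, g (T t) = ∫ t, g t := by
  have h := integral_map (μ := volume) (f := g) hT.measurable.aemeasurable (by rwa [hT.map_eq])
  rw [hT.map_eq] at h
  exact h.symm

theorem ae_eq_of_setIntegral_Ioi_eq {g k : unitInterval → ℝ} (hg : Integrable g)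
    (hk : Integrable k) (h : ∀ s, ∫ t in Ioi s, g t = ∫ t in Ioi s, k t) : g =ᵐ[volume] k := by
  have hIoc : ∀ a b : unitInterval, a ≤ b → ∫ t in Ioc a b, g t = ∫ t in Ioc a b, k t := by
    intro a b hab
    have hd : Disjoint (Ioc a b) (Ioi b) := disjoint_left.2 fun t h1 h2 => not_lt.2 h1.2 h2
    have h1 := h a
    rw [← Ioc_union_Ioi_eq_Ioi hab, setIntegral_union hd measurableSet_Ioi hg.integrableOn
      hg.integrableOn, setIntegral_union hd measurableSet_Ioi hk.integrableOn hk.integrableOn,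
      h b] at h1
    exact add_right_cancel h1
  have h1 := ae_nonneg_of_setIntegral_Ioc_nonneg (hg.sub hk) fun a b hab => by
    simp only [Pi.sub_apply]
    rw [integral_sub hg.integrableOn hk.integrableOn, hIoc a b hab, sub_self]
  have h2 := ae_nonneg_of_setIntegral_Ioc_nonneg (hk.sub hg) fun a b hab => by
    simp only [Pi.sub_apply]
    rw [integral_sub hk.integrableOn hg.integrableOn, hIoc a b hab, sub_self]
  filter_upwards [h1, h2] with t h1 h2
  simp only [Pi.zero_apply, Pi.sub_apply] at h1 h2
  linarith

/-- If integration against `ν` is law invariant and `ν = k ∘ T`, then `ν = k`. -/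
theorem ae_eq_of_permutationInvariant {ν : Linfty} (hν : StronglyPermutationInvariant (pairing ν))
    {k : unitInterval → ℝ} (hk : Integrable k) {T : unitInterval → unitInterval}
    (hT : MeasurePreserving T volume volume) (h : ν =ᵐ[volume] k ∘ T) : ν =ᵐ[volume] k := by
  refine ae_eq_of_setIntegral_Ioi_eq (integrable_Linfty ν) hk fun s => ?_
  have hs : step s =ᵐ[volume] (Ioi s).indicator fun _ => 1 := indicatorConstLp_coeFn
  rw [← pairing_step, hν T hT, pairing_apply, ← integral_indicator measurableSet_Ioi,
    ← integral_comp_measurePreserving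
      (hk.aestronglyMeasurable.indicator measurableSet_Ioi) hT]
  apply integral_congr_ae
  filter_upwards [Lp.coeFn_compMeasurePreserving (step s) hT, h,
    hT.quasiMeasurePreserving.ae_eq_comp hs] with t h1 h2 h3
  rw [h1, h2, h3, Function.comp_apply, Function.comp_apply]
  by_cases ht : T t ∈ Ioi s <;> simp [ht]

theorem ae_eq_one_of_permutationInvariant {ν : Linfty} (hν : ν ∈ densities)
    (h : StronglyPermutationInvariant (pairing ν)) : ∀ᵐ t, ν t = 1 := by
  have hm : Measurable ν := (Lp.stronglyMeasurable ν).measurable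
  have hi := integrable_Linfty ν
  have hqi := integrable_quantile hm hi
  have hσ := unitInterval.measurePreserving_symm
  have h1 : ν =ᵐ[volume] quantile ν := ae_eq_of_permutationInvariant h hqi
    (measurePreserving_rank hm) (quantile_comp_rank_self hm hi).symm
  -- Reflection is an involution, so `quantile ν` is `(quantile ν ∘ symm) ∘ symm`.
  have h2 : ν =ᵐ[volume] quantile ν ∘ unitInterval.symm := by
    refine ae_eq_of_permutationInvariant h
      ((hσ.integrable_comp hqi.aestronglyMeasurable).2 hqi) hσ ?_
    refine h1.trans (.of_forall fun t => ?_)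
    simp
  have hsymm := h1.symm.trans h2
  have hmono := monotoneOn_quantile hm
  let half : unitInterval := ⟨1 / 2, by norm_num, by norm_num⟩
  have hconst : ∀ x ∈ Ioo (0 : unitInterval) 1, quantile ν x = quantile ν half := by
    intro x hx
    have hx0 : (0 : ℝ) < x := hx.1
    have hx1 : (x : ℝ) < 1 := hx.2
    -- Symmetry holds only almost everywhere, so a good `t` is picked from `(0,m)`. Then `x` and
    -- `1/2` both lie in `[t, 1 - t]`, where equal end values and monotonicity force constancy.
    let m : unitInterval := min (min x (unitInterval.symm x)) half
    have hm0 : (0 : unitInterval) < m := by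
      refine lt_min (lt_min hx.1 ?_) ?_
      · change (0 : ℝ) < 1 - x
        linarith
      · change (0 : ℝ) < 1 / 2
        norm_num
    have hvol : volume (Ioo 0 m) ≠ 0 := by
      rw [unitInterval.volume_Ioo, ne_eq, ENNReal.ofReal_eq_zero, not_le]
      exact sub_pos.2 hm0
    obtain ⟨t, ht, hts⟩ := Measure.exists_mem_of_measure_ne_zero_of_ae hvol (ae_restrict_of_ae hsymm)
    have ht0 : (0 : ℝ) < t := ht.1
    have htm := lt_min_iff.1 ht.2
    have htx : (t : ℝ) < x := (lt_min_iff.1 htm.1).1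
    have htx' : (t : ℝ) < 1 - x := (lt_min_iff.1 htm.1).2
    have hth : (t : ℝ) < 1 / 2 := htm.2
    have htI : t ∈ Ioo (0 : unitInterval) 1 := ⟨ht.1, show (t : ℝ) < 1 by linarith⟩
    have hsI : unitInterval.symm t ∈ Ioo (0 : unitInterval) 1 :=
      ⟨show (0 : ℝ) < 1 - t by linarith, show (1 - t : ℝ) < 1 by linarith⟩
    have hhI : half ∈ Ioo (0 : unitInterval) 1 :=
      ⟨show (0 : ℝ) < 1 / 2 by norm_num, show (1 / 2 : ℝ) < 1 by norm_num⟩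
    have key : ∀ y ∈ Ioo (0 : unitInterval) 1, t ≤ y → y ≤ unitInterval.symm t →
        quantile ν y = quantile ν t := fun y hy h1 h2 =>
      le_antisymm ((hmono hy hsI h2).trans_eq hts.symm) (hmono htI hy h1)
    rw [key x hx htx.le (show (x : ℝ) ≤ 1 - t by linarith),
      key half hhI hth.le (show (1 / 2 : ℝ) ≤ 1 - t by linarith)]
  have hae : ∀ᵐ t, ν t = quantile ν half := by
    filter_upwards [h1, ae_mem_Ioo] with t h1 ht
    rw [h1, hconst t ht]
  have hone : quantile ν half = 1 := by
    have := hν.2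
    rw [integral_congr_ae hae] at this
    simpa using this
  filter_upwards [hae] with t ht
  rw [ht, hone]

theorem properties_of_integral {f : L1 → ℝ} (hf : ∀ φ : L1, f φ = ∫ t, φ t) :
    AffineInvariantOn univ f ∧ PointwiseMonotoneOn univ f ∧ FullyAdditive f ∧
      StronglyPermutationInvariant f ∧ L1LipschitzOn univ f := by
  have hone : (Lp.const ∞ (volume : Measure unitInterval) (1 : ℝ) : Linfty) =ᵐ[volume]
      fun _ => (1 : ℝ) := Lp.coeFn_const ∞ volume 1
  have hd : (Lp.const ∞ volume (1 : ℝ) : Linfty) ∈ densities := by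
    refine ⟨?_, ?_⟩
    · filter_upwards [hone] with t ht
      rw [ht]
      exact zero_le_one
    · rw [integral_congr_ae hone]
      simp
  obtain ⟨g1, g2, g3, g5⟩ := properties_of_density (D := univ) (f := f)
    (fun _ _ _ _ => trivial) (fun _ _ _ _ _ => trivial) hd (fun φ _ => by
      rw [hf]
      apply integral_congr_ae
      filter_upwards [hone] with t ht
      rw [ht, mul_one])
  refine ⟨g1, g2, fun φ ψ => g3 φ trivial ψ trivial, fun T hT φ => ?_, g5⟩
  rw [hf, hf, integral_congr_ae (Lp.coeFn_compMeasurePreserving φ hT)]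
  exact (integral_comp_measurePreserving (integrable_L1 φ).aestronglyMeasurable hT).symm

theorem ae_eq_one_of_repr {f : L1 → ℝ} (f4 : StronglyPermutationInvariant f) {ν : Linfty}
    (hν : ν ∈ densities) (hf : ∀ φ : L1, f φ = ∫ t, φ t * ν t) : ∀ᵐ t, ν t = 1 := by
  have h : f = pairing ν := funext fun φ => by rw [hf, pairing_apply]
  exact ae_eq_one_of_permutationInvariant hν (h ▸ f4)

end WGRM

theorem mainTheorem5 :
    -- (1) aggregation functions on the cone of non-decreasing left-continuous functions
    (∀ f : WGRM.L1 → ℝ,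
      (WGRM.AffineInvariantOn WGRM.monoCone f ∧ WGRM.PointwiseMonotoneOn WGRM.monoCone f ∧
          WGRM.ComonotonicAdditiveOn WGRM.monoCone f ∧ WGRM.L1LipschitzOn WGRM.monoCone f) ↔
        ∃! ν : WGRM.Linfty, ν ∈ WGRM.densities ∧
          ∀ φ ∈ WGRM.monoCone, f φ = ∫ t, φ t * ν t) ∧
    -- (1) aggregation functions on the whole of L¹
    (∀ f : WGRM.L1 → ℝ,
      (WGRM.AffineInvariantOn Set.univ f ∧ WGRM.PointwiseMonotoneOn Set.univ f ∧
          WGRM.ComonotonicAdditiveOn Set.univ f ∧ WGRM.L1LipschitzOn Set.univ f) →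
        ∃! ν : WGRM.Linfty, ν ∈ WGRM.densities ∧
          ∀ φ ∈ WGRM.monoCone, f φ = ∫ t, φ t * ν t) ∧
    -- (2)
    (∀ f : WGRM.L1 → ℝ,
      (WGRM.AffineInvariantOn Set.univ f ∧ WGRM.PointwiseMonotoneOn Set.univ f ∧
          WGRM.ComonotonicAdditiveOn Set.univ f ∧ WGRM.StronglyPermutationInvariant f ∧
          WGRM.L1LipschitzOn Set.univ f) ↔
        ∃! ν : WGRM.Linfty, ν ∈ WGRM.densities ∧
          ∀ φ : WGRM.L1, Integrable (fun t => WGRM.quantile φ t * ν t) ∧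
            f φ = ∫ t, WGRM.quantile φ t * ν t) ∧
    -- (3)
    (∀ f : WGRM.L1 → ℝ,
      (WGRM.AffineInvariantOn Set.univ f ∧ WGRM.PointwiseMonotoneOn Set.univ f ∧
          WGRM.FullyAdditive f ∧ WGRM.L1LipschitzOn Set.univ f) ↔
        ∃! ν : WGRM.Linfty, ν ∈ WGRM.densities ∧
          ∀ φ : WGRM.L1, f φ = ∫ t, φ t * ν t) ∧
    -- (4)
    (∀ f : WGRM.L1 → ℝ,
      ((WGRM.AffineInvariantOn Set.univ f ∧ WGRM.PointwiseMonotoneOn Set.univ f ∧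
          WGRM.FullyAdditive f ∧ WGRM.StronglyPermutationInvariant f ∧
          WGRM.L1LipschitzOn Set.univ f) ↔
        ∀ φ : WGRM.L1, f φ = ∫ t, φ t) ∧
      ((WGRM.AffineInvariantOn Set.univ f ∧ WGRM.PointwiseMonotoneOn Set.univ f ∧
          WGRM.FullyAdditive f ∧ WGRM.StronglyPermutationInvariant f ∧
          WGRM.L1LipschitzOn Set.univ f) →
        ∀ ν ∈ WGRM.densities, (∀ φ : WGRM.L1, f φ = ∫ t, φ t * ν t) →
          ∀ᵐ t, ν t = 1)) := by
  refine ⟨fun f => ⟨fun ⟨f1, f2, f3, f5⟩ => ?_, fun h => ?_⟩, fun f ⟨f1, f2, f3, f5⟩ => ?_,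
    fun f => ⟨fun ⟨f1, f2, f3, f4, f5⟩ => ?_, fun h => ?_⟩,
    fun f => ⟨fun ⟨f1, f2, f3, f5⟩ => ?_, fun h => ?_⟩,
    fun f => ⟨⟨fun ⟨f1, f2, f3, f4, f5⟩ φ => ?_, fun h => ?_⟩,
      fun ⟨_, _, _, f4, _⟩ ν hν hf => ?_⟩⟩
  · exact WGRM.existsUnique_density_on_monoCone f1 f2 f3 f5
  · obtain ⟨ν, ⟨hν, hf⟩, -⟩ := h
    obtain ⟨g1, g2, g3, g5⟩ := WGRM.properties_of_density
      (fun _ hx _ hy => WGRM.monoCone_add hx hy)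
      (fun _ hx _ b ha => WGRM.monoCone_affine hx ha b) hν hf
    exact ⟨g1, g2, fun φ hφ ψ hψ _ => g3 φ hφ ψ hψ, g5⟩
  · exact WGRM.existsUnique_density_on_monoCone_of_univ f1 f2 f3 f5
  · exact WGRM.existsUnique_quantile_density f1 f2 f3 f4 f5
  · obtain ⟨ν, ⟨hν, hf⟩, -⟩ := h
    exact WGRM.properties_of_quantile_density hν fun φ => (hf φ).2
  · exact WGRM.existsUnique_density_on_univ f1 f2 f3 f5
  · obtain ⟨ν, ⟨hν, hf⟩, -⟩ := h
    obtain ⟨g1, g2, g3, g5⟩ := WGRM.properties_of_density (D := Set.univ)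
      (fun _ _ _ _ => trivial) (fun _ _ _ _ _ => trivial) hν (fun φ _ => hf φ)
    exact ⟨g1, g2, fun φ ψ => g3 φ trivial ψ trivial, g5⟩
  · obtain ⟨ν, ⟨hν, hf⟩, -⟩ := WGRM.existsUnique_density_on_univ f1 f2 f3 f5
    rw [hf]
    apply integral_congr_ae
    filter_upwards [WGRM.ae_eq_one_of_repr f4 hν hf] with t ht
    rw [ht, mul_one]
  · exact WGRM.properties_of_integral h
  · exact WGRM.ae_eq_one_of_repr f4 hν hf
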